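/- A finite simple graph $G$ with $q$ edges is called antimagic if there is a bijection $f : E(G) \to \{1, 2, \dots, q\}$ such that the vertex sums $\phi_f(v) = \sum_{e \ni v} f(e)$ (the sum over the edges $e$ of $G$ incident to $v$) are pairwise distinct for distinct vertices $v \in V(G)$. The tensor product $G \times H$ has vertex set $V(G) \times V(H)$, and $(x_1, y_1)$, $(x_2, y_2)$ are adjacent if and only if $x_1 x_2 \in E(G)$ and $y_1 y_2 \in E(H)$. For $m \ge 3$, the wheel $W_m$ is obtained from the cycle $C_m$ on vertices $u_1, \dots, u_m$ by adding a central vertex $u_0$ joined to every $u_i$, $1 \le i \le m$, and the helm $H_m$ is obtained from $W_m$ by adding $m$ new vertices $u_{m+1}, \dots, u_{2m}$ and joining $u_{m+i}$ to $u_i$ for $1 \le i \le m$. Let $K_{1,n}$ denote the star with $n$ leaves. Theorem. For all integers $m \ge 3$ and $n \ge 2$, the tensor product $H_m \times K_{1,n}$ has exactly $6mn$ edges and is antimagic. -/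

import Mathlib

namespace AntimagicLabeling

/-- The tensor (direct) product `G × H` of graphs: `(x₁, y₁)` and `(x₂, y₂)` are adjacent iff
`x₁ x₂` is an edge of `G` and `y₁ y₂` is an edge of `H`. -/
def tensorProduct {V W : Type*} (G : SimpleGraph V) (H : SimpleGraph W) :
    SimpleGraph (V × W) where
  Adj p q := G.Adj p.1 q.1 ∧ H.Adj p.2 q.2
  symm := ⟨fun _ _ h => ⟨h.1.symm, h.2.symm⟩⟩
  loopless := ⟨fun _ h => G.irrefl h.1⟩

/-- Adjacency in the wheel: `none` is the central vertex `u₀`, the vertices `some i` form the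
rim cycle `C_m`, and the centre is joined to every rim vertex. -/
def wheelAdj (m : ℕ) : Option (Fin m) → Option (Fin m) → Prop
  | none, none => False
  | none, some _ => True
  | some _, none => True
  | some i, some j => (SimpleGraph.cycleGraph m).Adj i j

/-- The wheel `W_m` (a cycle on `m` vertices plus a centre). -/
def wheel (m : ℕ) : SimpleGraph (Option (Fin m)) where
  Adj := wheelAdj m
  symm := ⟨fun a b h => by
    cases a <;> cases b <;> first | exact h | exact SimpleGraph.Adj.symm h⟩
  loopless := ⟨fun a h => by
    cases a
    · exact h
    · exact SimpleGraph.irrefl _ h⟩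

/-- Adjacency in the helm: the vertices `Sum.inl a` form the wheel, and the new vertex
`Sum.inr i` is joined exactly to the rim vertex `some i`. -/
def helmAdj (m : ℕ) : Option (Fin m) ⊕ Fin m → Option (Fin m) ⊕ Fin m → Prop
  | Sum.inl a, Sum.inl b => (wheel m).Adj a b
  | Sum.inl a, Sum.inr i => a = some i
  | Sum.inr i, Sum.inl a => a = some i
  | Sum.inr _, Sum.inr _ => False

/-- The helm `H_m`: the wheel `W_m` with a pendant vertex attached to each rim vertex. -/
def helm (m : ℕ) : SimpleGraph (Option (Fin m) ⊕ Fin m) where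
  Adj := helmAdj m
  symm := ⟨fun a b h => by
    cases a <;> cases b <;> first | exact h | exact SimpleGraph.Adj.symm h⟩
  loopless := ⟨fun a h => by
    cases a
    · exact SimpleGraph.irrefl _ h
    · exact h⟩

/-- The star `K_{1,n}`. -/
def star (n : ℕ) : SimpleGraph (Fin 1 ⊕ Fin n) :=
  completeBipartiteGraph (Fin 1) (Fin n)

open Classical in
/-- The vertex sum of `v`: the sum of the labels of the edges of `G` incident to `v`. -/
noncomputable def vertexSum {V : Type*} [Fintype V] (G : SimpleGraph V) (f : Sym2 V → ℕ)
    (v : V) : ℕ :=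
  ∑ e ∈ G.incidenceFinset v, f e

/-- A finite graph with `q` edges is antimagic if its edges can be labelled bijectively by
`1, …, q` so that distinct vertices have distinct vertex sums. (The values of `f` outside the
edge set are irrelevant.) -/
def IsAntimagic {V : Type*} [Fintype V] (G : SimpleGraph V) : Prop :=
  ∃ f : Sym2 V → ℕ, Set.BijOn f G.edgeSet (Set.Icc 1 G.edgeSet.ncard) ∧
    ∀ u v : V, u ≠ v → vertexSum G f u ≠ vertexSum G f v

end AntimagicLabeling

/-!
The edges of `H_m × K_{1,n}` are the triples `(t, i, j)`, where `(t, i)` is one of the `6 m`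
oriented edges of the helm, sorted into six classes `t` of size `m`, and `j` is a leaf of the star
(`edge_injective`, `range_edge`). Each class receives a block of `N = m n` consecutive labels, and
the blocks and the order inside them are chosen so that the vertex sums of the six kinds of
vertices fall into disjoint intervals and are distinct inside each of them.

The edges at a pendant vertex over a leaf get the labels `1, …, N`; these are the smallest sums. The
edges at the hub over the centre get the block `4 N + 1, …, 5 N`. Their `N` labels add up to the
largest sum of all, in whatever order they are used; as each of them ends at a different rim vertex
over a leaf, that order is free to be the increasing order of the partial sums there
(`exists_rank_add_injective`), which makes the sums at the rim vertices over the leaves distinct.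
These sums lie in `(10 N, 14 N]`.

The three remaining kinds of sums are arithmetic progressions: at the hub over the leaves close to
`11 m N / 2`, at pendant vertices over the centre close to `(2 b + 1) n N / 2`, and at rim vertices
over the centre close to `(13 - b) n N`, each within `N` up to a lower-order term
(`two_mul_hub_leaf`, `two_mul_pendant_centre`, `two_mul_rim_centre`). Here `b ∈ {1, 2, 3}` is the
block of the edges at the pendant vertices over the centre, and `exists_block_choice` shows that for
all `m ≥ 3` and `n ≥ 2` some `b` keeps these intervals apart from each other and from
`(10 N, 14 N]`.
-/

namespace AntimagicLabeling

open Finset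

/-! ### Antimagic labellings from an enumeration of the edges -/

/-- Labelling the edges of `G` amounts to labelling an index type `ι` that enumerates them through
`ε`; an injective labelling with values in `{1, …, |ι|}` is then automatically onto. -/
theorem isAntimagic_of_enumeration {V ι : Type*} [Fintype V] [Fintype ι] (G : SimpleGraph V)
    (ε : ι → Sym2 V) (hε : Function.Injective ε) (hrange : Set.range ε = G.edgeSet)
    (l : ι → ℕ) (hl : Function.Injective l) (hl1 : ∀ k, 1 ≤ l k) (hl2 : ∀ k, l k ≤ Fintype.card ι)
    (hsum : ∀ f : Sym2 V → ℕ, (∀ k, f (ε k) = l k) → Function.Injective (vertexSum G f)) :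
    IsAntimagic G := by
  classical
  have hf : ∀ k, Function.extend ε l 0 (ε k) = l k := fun k => hε.extend_apply l 0 k
  have hcard : G.edgeSet.ncard = Fintype.card ι := by
    rw [← hrange, ← Set.image_univ, Set.ncard_image_of_injective _ hε, Set.ncard_univ,
      Nat.card_eq_fintype_card]
  refine ⟨Function.extend ε l 0, ?_, fun u v huv h => huv (hsum _ hf h)⟩
  rw [hcard]
  have himage : univ.image l = Icc 1 (Fintype.card ι) := by
    apply eq_of_subset_of_card_le
    · intro x hx
      obtain ⟨k, -, rfl⟩ := mem_image.1 hx
      exact mem_Icc.2 ⟨hl1 k, hl2 k⟩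
    · rw [card_image_of_injective _ hl]
      simp
  rw [← hrange]
  refine ⟨?_, ?_, ?_⟩
  · rintro _ ⟨k, rfl⟩
    rw [hf]
    exact ⟨hl1 k, hl2 k⟩
  · rintro _ ⟨k, rfl⟩ _ ⟨k', rfl⟩ h
    rw [hf, hf] at h
    rw [hl h]
  · intro x hx
    have : x ∈ univ.image l := by rw [himage]; simpa using hx
    obtain ⟨k, -, rfl⟩ := mem_image.1 this
    exact ⟨ε k, ⟨k, rfl⟩, hf k⟩

open Classical in
/-- The vertex sum at `v`, read off an enumeration `ε` of the edges. -/
theorem vertexSum_eq_sum_ite {V ι : Type*} [Fintype V] [Fintype ι] (G : SimpleGraph V)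
    (ε : ι → Sym2 V) (hε : Function.Injective ε) (hrange : Set.range ε = G.edgeSet)
    (f : Sym2 V → ℕ) (v : V) :
    vertexSum G f v = ∑ k, if v ∈ ε k then f (ε k) else 0 := by
  have h : G.incidenceFinset v = (univ.filter fun k => v ∈ ε k).image ε := by
    ext e
    rw [SimpleGraph.mem_incidenceFinset, SimpleGraph.incidenceSet, Set.mem_ofPred_eq, ← hrange]
    simp only [mem_image, mem_filter, mem_univ, true_and, Set.mem_range]
    constructor
    · rintro ⟨⟨k, rfl⟩, hv⟩
      exact ⟨k, hv, rfl⟩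
    · rintro ⟨k, hv, rfl⟩
      exact ⟨⟨k, rfl⟩, hv⟩
  rw [vertexSum, h, sum_image hε.injOn, sum_filter]

/-- Whatever the partial sums `s`, adding to each its rank in increasing order of `s` (ties broken
arbitrarily) makes them distinct. -/
theorem exists_rank_add_injective {α : Type*} [Fintype α] (s : α → ℕ) :
    ∃ σ : α → ℕ, Function.Injective σ ∧ (∀ x, σ x < Fintype.card α) ∧
      Function.Injective fun x => s x + σ x := by
  let e := Fintype.equivFin α
  let p := Tuple.sort (s ∘ e.symm)
  have hp : Monotone ((s ∘ e.symm) ∘ p) := Tuple.monotone_sort _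
  have key : ∀ x y, p.symm (e x) ≤ p.symm (e y) → s x ≤ s y := fun x y h => by
    simpa using hp h
  refine ⟨fun x => p.symm (e x), fun x y h => ?_, fun x => (p.symm (e x)).2, fun x y h => ?_⟩
  · simpa using Fin.ext h
  · rcases lt_trichotomy (p.symm (e x)) (p.symm (e y)) with hlt | heq | hlt
    · have := key x y hlt.le
      have : (p.symm (e x) : ℕ) < p.symm (e y) := hlt
      dsimp only at h
      omega
    · simpa using heq
    · have := key y x hlt.le
      have : (p.symm (e y) : ℕ) < p.symm (e x) := hlt
      dsimp only at h
      omega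

/-! ### The edges of the tensor product of a helm and a star -/

/-- The helm has `6 m` oriented edges, in six classes indexed by `Fin 6`, each class indexed by
`Fin m`: rim to pendant (`0`), pendant to rim (`1`), rim to next rim vertex (`2`), rim to previous
rim vertex (`3`), hub to rim (`4`), rim to hub (`5`). This is the tail of such an edge. -/
def edgeSource (m : ℕ) : Fin 6 → Fin m → Option (Fin m) ⊕ Fin m
  | 0, i => .inl (some i)
  | 1, i => .inr i
  | 2, i => .inl (some i)
  | 3, i => .inl (some i)
  | 4, _ => .inl none
  | 5, i => .inl (some i)

/-- The head of the `i`-th oriented edge of class `t` of the helm, in the enumeration described at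
`edgeSource`. The index of a cycle edge is its tail, and rim indices are added cyclically. -/
def edgeTarget (m : ℕ) [NeZero m] : Fin 6 → Fin m → Option (Fin m) ⊕ Fin m
  | 0, i => .inr i
  | 1, i => .inl (some i)
  | 2, i => .inl (some (i + 1))
  | 3, i => .inl (some (i - 1))
  | 4, i => .inl (some i)
  | 5, _ => .inl none

/-- An oriented edge `x → y` of the helm and a leaf `j` of the star give the edge joining `x` over
the centre of the star to `y` over the leaf `j`; every edge of the tensor product arises exactly
once in this way. -/
def edge (m n : ℕ) [NeZero m] (k : Fin 6 × Fin m × Fin n) :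
    Sym2 ((Option (Fin m) ⊕ Fin m) × (Fin 1 ⊕ Fin n)) :=
  s((edgeSource m k.1 k.2.1, .inl 0), (edgeTarget m k.1 k.2.1, .inr k.2.2))

theorem cycleGraph_adj_iff_eq_add_or_sub {m : ℕ} [NeZero m] (hm : 3 ≤ m) (i j : Fin m) :
    (SimpleGraph.cycleGraph m).Adj i j ↔ j = i + 1 ∨ j = i - 1 := by
  obtain ⟨k, rfl⟩ := Nat.exists_eq_add_of_le' hm
  rw [SimpleGraph.cycleGraph_adj, or_comm]
  refine or_congr ⟨fun h => ?_, fun h => ?_⟩ ⟨fun h => ?_, fun h => ?_⟩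
  · rw [← h]; abel
  · rw [h]; abel
  · rw [← h]; abel
  · rw [h]; abel

/-- This separates the two cycle edges leaving a rim vertex; it fails for `m = 2`. -/
theorem add_one_ne_sub_one {m : ℕ} [NeZero m] (hm : 3 ≤ m) (i : Fin m) : i + 1 ≠ i - 1 := by
  obtain ⟨k, rfl⟩ := Nat.exists_eq_add_of_le' hm
  intro h
  have h2 : (1 : Fin (k + 3)) + 1 = 0 := by
    have : i + (1 + 1) = i + 0 := by
      rw [← add_assoc, h]; abel
    exact add_left_cancel this
  have := congrArg Fin.val h2
  simp [Fin.val_add, Nat.mod_eq_of_lt] at this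

theorem edgeSource_edgeTarget_injective {m : ℕ} [NeZero m] (hm : 3 ≤ m) {t t' : Fin 6}
    {i i' : Fin m} (h : edgeSource m t i = edgeSource m t' i')
    (h' : edgeTarget m t i = edgeTarget m t' i') : t = t' ∧ i = i' := by
  have h1 := add_one_ne_sub_one hm i
  fin_cases t <;> fin_cases t' <;> simp [edgeSource, edgeTarget] at h h' ⊢ <;> grind

theorem helm_adj_iff {m : ℕ} [NeZero m] (hm : 3 ≤ m) (x y : Option (Fin m) ⊕ Fin m) :
    (helm m).Adj x y ↔ ∃ t i, edgeSource m t i = x ∧ edgeTarget m t i = y := by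
  constructor
  · intro h
    change helmAdj m x y at h
    rcases x with (_ | i) | i <;> rcases y with (_ | j) | j
    · exact h.elim
    · exact ⟨4, j, rfl, rfl⟩
    · cases h
    · exact ⟨5, i, rfl, rfl⟩
    · rcases (cycleGraph_adj_iff_eq_add_or_sub hm i j).1 h with rfl | rfl
      · exact ⟨2, i, rfl, rfl⟩
      · exact ⟨3, i, rfl, rfl⟩
    · obtain rfl : i = j := by simpa [helmAdj] using h
      exact ⟨0, i, rfl, rfl⟩
    · cases h
    · obtain rfl : j = i := by simpa [helmAdj] using h
      exact ⟨1, j, rfl, rfl⟩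
    · exact h.elim
  · rintro ⟨t, i, rfl, rfl⟩
    change helmAdj m _ _
    have hc := cycleGraph_adj_iff_eq_add_or_sub hm i
    fin_cases t
    · rfl
    · rfl
    · exact (hc _).2 (.inl rfl)
    · exact (hc _).2 (.inr rfl)
    · trivial
    · trivial

theorem edge_injective {m : ℕ} (n : ℕ) [NeZero m] (hm : 3 ≤ m) :
    Function.Injective (edge m n) := by
  rintro ⟨t, i, j⟩ ⟨t', i', j'⟩ h
  simp only [edge, Sym2.eq_iff, Prod.mk.injEq, reduceCtorEq, and_false, or_false,
    and_true, Sum.inr.injEq] at h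
  obtain ⟨rfl, rfl⟩ := edgeSource_edgeTarget_injective hm h.1 h.2.1
  rw [h.2.2]

theorem range_edge {m : ℕ} (n : ℕ) [NeZero m] (hm : 3 ≤ m) :
    Set.range (edge m n) = (tensorProduct (helm m) (star n)).edgeSet := by
  ext e
  constructor
  · rintro ⟨⟨t, i, j⟩, rfl⟩
    exact ⟨(helm_adj_iff hm _ _).2 ⟨t, i, rfl, rfl⟩, by simp [star]⟩
  · induction e using Sym2.ind with
    | _ p q =>
      obtain ⟨x, a⟩ := p
      obtain ⟨y, b⟩ := q
      rintro ⟨h, hs⟩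
      rcases a with a | j <;> rcases b with b | j'
      · simp [star] at hs
      · obtain ⟨t, i, hx, hy⟩ := (helm_adj_iff hm _ _).1 h
        refine ⟨(t, i, j'), ?_⟩
        rw [Subsingleton.elim a 0]
        simp only [edge]
        rw [hx, hy]
      · obtain ⟨t, i, hx, hy⟩ := (helm_adj_iff hm _ _).1 h.symm
        refine ⟨(t, i, j), ?_⟩
        rw [Subsingleton.elim b 0, Sym2.eq_swap]
        simp only [edge]
        rw [hx, hy]
      · simp [star] at hs

section VertexSums

variable {m n : ℕ} [NeZero m] (hm : 3 ≤ m) (l : Fin 6 × Fin m × Fin n → ℕ)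
  (f : Sym2 ((Option (Fin m) ⊕ Fin m) × (Fin 1 ⊕ Fin n)) → ℕ) (hf : ∀ k, f (edge m n k) = l k)

include hm hf

theorem vertexSum_centre (x : Option (Fin m) ⊕ Fin m) :
    vertexSum (tensorProduct (helm m) (star n)) f (x, .inl 0) =
      ∑ t, ∑ i, if x = edgeSource m t i then ∑ j, l (t, i, j) else 0 := by
  classical
  rw [vertexSum_eq_sum_ite _ _ (edge_injective n hm) (range_edge n hm), Fintype.sum_prod_type]
  refine sum_congr rfl fun t _ => ?_
  rw [Fintype.sum_prod_type]
  refine sum_congr rfl fun i _ => ?_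
  simp only [hf]
  simp [edge]

theorem vertexSum_leaf (y : Option (Fin m) ⊕ Fin m) (j : Fin n) :
    vertexSum (tensorProduct (helm m) (star n)) f (y, .inr j) =
      ∑ t, ∑ i, if y = edgeTarget m t i then l (t, i, j) else 0 := by
  classical
  rw [vertexSum_eq_sum_ite _ _ (edge_injective n hm) (range_edge n hm), Fintype.sum_prod_type]
  refine sum_congr rfl fun t _ => ?_
  rw [Fintype.sum_prod_type]
  refine sum_congr rfl fun i _ => ?_
  simp only [hf]
  simp [edge, ite_and]

theorem vertexSum_hub_centre :
    vertexSum (tensorProduct (helm m) (star n)) f (.inl none, .inl 0) =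
      ∑ i, ∑ j, l (4, i, j) := by
  rw [vertexSum_centre hm l f hf]
  simp [Fin.sum_univ_six, edgeSource]

theorem vertexSum_rim_centre (i : Fin m) :
    vertexSum (tensorProduct (helm m) (star n)) f (.inl (some i), .inl 0) =
      ∑ j, l (0, i, j) + ∑ j, l (2, i, j) + ∑ j, l (3, i, j) + ∑ j, l (5, i, j) := by
  rw [vertexSum_centre hm l f hf]
  simp [Fin.sum_univ_six, edgeSource]

theorem vertexSum_pendant_centre (i : Fin m) :
    vertexSum (tensorProduct (helm m) (star n)) f (.inr i, .inl 0) = ∑ j, l (1, i, j) := by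
  rw [vertexSum_centre hm l f hf]
  simp [Fin.sum_univ_six, edgeSource]

theorem vertexSum_hub_leaf (j : Fin n) :
    vertexSum (tensorProduct (helm m) (star n)) f (.inl none, .inr j) = ∑ i, l (5, i, j) := by
  rw [vertexSum_leaf hm l f hf]
  simp [Fin.sum_univ_six, edgeTarget]

theorem vertexSum_rim_leaf (i : Fin m) (j : Fin n) :
    vertexSum (tensorProduct (helm m) (star n)) f (.inl (some i), .inr j) =
      l (1, i, j) + l (2, i - 1, j) + l (3, i + 1, j) + l (4, i, j) := by
  rw [vertexSum_leaf hm l f hf]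
  have h1 : ∀ x : Fin m, i = x + 1 ↔ i - 1 = x := fun x => sub_eq_iff_eq_add.symm
  have h2 : ∀ x : Fin m, i = x - 1 ↔ i + 1 = x := fun x => eq_sub_iff_add_eq
  simp [Fin.sum_univ_six, edgeTarget, h1, h2]

theorem vertexSum_pendant_leaf (i : Fin m) (j : Fin n) :
    vertexSum (tensorProduct (helm m) (star n)) f (.inr i, .inr j) = l (0, i, j) := by
  rw [vertexSum_leaf hm l f hf]
  simp [Fin.sum_univ_six, edgeTarget]

end VertexSums

/-! ### The labelling -/

/-- The arithmetic that makes the six intervals of vertex sums compatible. With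
`s = m - 2 * ((m - 1) / 2)`, and in units of `m * n / 2`, the sums at pendant vertices over the
centre lie in the interval of radius `1` about `(2 * b + 1) * n`, those at rim vertices over the
centre within about `2` of `2 * (13 - b) * n`, those at the hub over the leaves within `s` of
`11 * m`, and those at rim vertices over the leaves between `20` and `28`. -/
theorem exists_block_choice {m n : ℕ} (hm : 3 ≤ m) (hn : 2 ≤ n) :
    ∃ b : ℕ, (b = 1 ∨ b = 2 ∨ b = 3) ∧
      ((2 * b + 1) * n + 1 ≤ 20 ∨ 29 ≤ (2 * b + 1) * n) ∧
      ((2 * b + 1) * n + 1 + (m - 2 * ((m - 1) / 2)) ≤ 11 * m ∨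
        11 * m + (m - 2 * ((m - 1) / 2)) + 1 ≤ (2 * b + 1) * n) ∧
      (11 * m + (m - 2 * ((m - 1) / 2)) + 2 ≤ 2 * (13 - b) * n ∨
        2 * (13 - b) * n + 2 + (m - 2 * ((m - 1) / 2)) ≤ 11 * m) := by
  -- For `n ≤ 5` the value `b = 1` works, except when `m = 11` and `n = 5`. For `n ≥ 6` at most one
  -- of `b = 2` and `b = 3` runs into a collision, as the centres `(2 * b + 1) * n` and
  -- `2 * (13 - b) * n` each move by `2 * n` between them.
  by_cases hn5 : n ≤ 5
  · by_cases h : m = 11 ∧ n = 5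
    · obtain ⟨rfl, rfl⟩ := h
      exact ⟨3, by norm_num⟩
    · exact ⟨1, by interval_cases n <;> omega⟩
  · by_contra! hb
    have h2 := hb 2 (by norm_num)
    have h3 := hb 3 (by norm_num)
    omega

/-- The position of `(i, j)` when `Fin m × Fin n` is listed with `i` varying fastest. -/
def position {m n : ℕ} (i : Fin m) (j : Fin n) : ℕ := j * m + i

/-- The relative position, counted from `0`, of the edge `(t, i, j)` in the block of labels of its
class `t`. For a fixed `j`, class `5` runs through the leaves in reverse order on the first
`(m - 1) / 2` rim vertices: this leaves the sums over `j` unchanged and squeezes the sums over `i`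
into an interval of length at most `2 * m * n`. Class `3` reverses the rim, so that the sums at rim
vertices over the centre vary less. Class `4` is ordered by an arbitrary `σ`. -/
def offset {m n : ℕ} (σ : Fin m × Fin n → ℕ) : Fin 6 → Fin m → Fin n → ℕ
  | 0, i, j => position i j
  | 1, i, j => position i j
  | 2, i, j => position i j
  | 3, i, j => position i.rev j
  | 4, i, j => σ (i, j)
  | 5, i, j => position i (if (i : ℕ) < (m - 1) / 2 then j.rev else j)

/-- The position of the block of labels of each class. Class `1` receives block `b ∈ {1, 2, 3}` and
classes `2` and `3` the other two blocks among `1`, `2`, `3`. -/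
def block (b : ℕ) : Fin 6 → ℕ :=
  ![0, b, if b = 1 then 2 else 1, if b = 3 then 2 else 3, 4, 5]

/-- The label of the edge `(t, i, j)`: class `t` uses the `m * n` consecutive labels that follow
`block b t * (m * n)`. -/
def label {m n : ℕ} (b : ℕ) (σ : Fin m × Fin n → ℕ) (k : Fin 6 × Fin m × Fin n) : ℕ :=
  block b k.1 * (m * n) + offset σ k.1 k.2.1 k.2.2 + 1

theorem position_lt {m n : ℕ} (i : Fin m) (j : Fin n) : position i j < m * n := by
  have h1 := i.2
  have h2 : ((j : ℕ) + 1) * m ≤ n * m := Nat.mul_le_mul_right m j.2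
  unfold position
  linarith

theorem position_inj {m n : ℕ} {i i' : Fin m} {j j' : Fin n}
    (h : position i j = position i' j') : i = i' ∧ j = j' := by
  unfold position at h
  have hi := congrArg (· % m) h
  simp only [Nat.mul_add_mod_self_right, Nat.mod_eq_of_lt i.2, Nat.mod_eq_of_lt i'.2] at hi
  rw [hi, Nat.add_right_cancel_iff] at h
  exact ⟨Fin.ext hi, Fin.ext (Nat.eq_of_mul_eq_mul_right i.pos h)⟩

theorem offset_lt {m n : ℕ} {σ : Fin m × Fin n → ℕ} (hσ : ∀ x, σ x < m * n) (t : Fin 6)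
    (i : Fin m) (j : Fin n) : offset σ t i j < m * n := by
  fin_cases t
  all_goals first | exact position_lt _ _ | exact hσ _

theorem offset_inj {m n : ℕ} {σ : Fin m × Fin n → ℕ} (hσ : Function.Injective σ) {t : Fin 6}
    {i i' : Fin m} {j j' : Fin n} (h : offset σ t i j = offset σ t i' j') :
    i = i' ∧ j = j' := by
  fin_cases t
  · exact position_inj h
  · exact position_inj h
  · exact position_inj h
  · exact (position_inj h).imp_left Fin.rev_injective.eq_iff.1
  · exact Prod.mk.inj (hσ h)
  · obtain ⟨rfl, h⟩ := position_inj h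
    refine ⟨rfl, ?_⟩
    split_ifs at h
    · exact Fin.rev_injective h
    · exact h

theorem block_injective {b : ℕ} (hb : b = 1 ∨ b = 2 ∨ b = 3) : Function.Injective (block b) := by
  rcases hb with rfl | rfl | rfl <;> decide

theorem block_le {b : ℕ} (hb : b = 1 ∨ b = 2 ∨ b = 3) (t : Fin 6) : block b t ≤ 5 := by
  rcases hb with rfl | rfl | rfl <;> revert t <;> decide

theorem block_two_add_block_three {b : ℕ} (hb : b = 1 ∨ b = 2 ∨ b = 3) :
    block b 2 + block b 3 + b = 6 := by
  rcases hb with rfl | rfl | rfl <;> rfl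

theorem label_injective {m n b : ℕ} {σ : Fin m × Fin n → ℕ} (hb : b = 1 ∨ b = 2 ∨ b = 3)
    (hσ : Function.Injective σ) (hσlt : ∀ x, σ x < m * n) : Function.Injective (label b σ) := by
  rintro ⟨t, i, j⟩ ⟨t', i', j'⟩ h
  simp only [label, Nat.add_right_cancel_iff] at h
  have h1 := offset_lt hσlt t i j
  have h2 := offset_lt hσlt t' i' j'
  have ho := congrArg (· % (m * n)) h
  simp only [Nat.mul_add_mod_self_right, Nat.mod_eq_of_lt h1, Nat.mod_eq_of_lt h2] at ho
  rw [ho, Nat.add_right_cancel_iff] at h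
  obtain rfl := block_injective hb (Nat.eq_of_mul_eq_mul_right (by omega) h)
  obtain ⟨rfl, rfl⟩ := offset_inj hσ ho
  rfl

theorem label_le {m n b : ℕ} {σ : Fin m × Fin n → ℕ} (hb : b = 1 ∨ b = 2 ∨ b = 3)
    (hσlt : ∀ x, σ x < m * n) (k : Fin 6 × Fin m × Fin n) : label b σ k ≤ 6 * (m * n) := by
  have h1 := offset_lt hσlt k.1 k.2.1 k.2.2
  have h2 : block b k.1 * (m * n) ≤ 5 * (m * n) := Nat.mul_le_mul_right _ (block_le hb _)
  unfold label
  omega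

/-! ### Exact values of the vertex sums -/

theorem two_mul_sum_fin (n : ℕ) : 2 * ∑ j : Fin n, (j : ℤ) = n * (n - 1) := by
  induction n with
  | zero => simp
  | succ n ih =>
    rw [Fin.sum_univ_castSucc, mul_add]
    simp only [Fin.val_castSucc, Fin.val_last]
    rw [ih]
    push_cast
    ring

theorem two_mul_sum_row {m n : ℕ} (c : ℤ) (i : Fin m) :
    2 * ∑ j : Fin n, (c + position i j) = n * (2 * c + 2 * i + m * (n - 1)) := by
  have h := two_mul_sum_fin n
  simp only [position, Nat.cast_add, Nat.cast_mul, sum_add_distrib, ← sum_mul, sum_const,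
    card_univ, Fintype.card_fin, nsmul_eq_mul]
  linear_combination (m : ℤ) * h

/-- Reversing `j` for the first `r` values of `i` reduces the slope of the sum as a function of
`j` from `m * m` to `m * (m - 2 * r)`. -/
theorem two_mul_sum_column {m n r : ℕ} (hr : r ≤ m) (c : ℤ) (j : Fin n) :
    2 * ∑ i : Fin m, (c + position i (if (i : ℕ) < r then j.rev else j)) =
      m * (2 * c + m - 1) + 2 * m * (r * (n - 1) + (m - 2 * r) * j) := by
  have h := two_mul_sum_fin m
  have hrev : ((j.rev : ℕ) : ℤ) = n - 1 - j := by
    rw [Fin.val_rev]; push_cast [Nat.succ_le_of_lt j.2]; ring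
  have hterm : ∀ i : Fin m, c + (position i (if (i : ℕ) < r then j.rev else j) : ℤ) =
      c + j * m + i + if (i : ℕ) < r then ((n : ℤ) - 1 - 2 * j) * m else 0 := by
    intro i
    unfold position
    split_ifs
    · push_cast [hrev]; ring
    · push_cast; ring
  have hcard : #{i : Fin m | (i : ℕ) < r} = r := by
    rw [Fin.card_filter_val_lt, min_eq_right hr]
  simp only [hterm, sum_add_distrib, sum_const, card_univ, Fintype.card_fin, nsmul_eq_mul,
    ← sum_filter, hcard]
  linear_combination h

theorem two_mul_sum_of_injective {α : Type*} [Fintype α] {σ : α → ℕ}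
    (hσ : Function.Injective σ) (hlt : ∀ x, σ x < Fintype.card α) :
    2 * ∑ x, (σ x : ℤ) = Fintype.card α * (Fintype.card α - 1) := by
  rw [← two_mul_sum_fin]
  congr 1
  have hbij : Function.Bijective fun x => (⟨σ x, hlt x⟩ : Fin (Fintype.card α)) :=
    (Fintype.bijective_iff_injective_and_card _).2
      ⟨fun x y h => hσ (congrArg Fin.val h), by simp⟩
  exact hbij.sum_comp (fun j : Fin (Fintype.card α) => ((j : ℕ) : ℤ))

section LabelSums

variable {m n b : ℕ} (σ : Fin m × Fin n → ℕ)

/-- Twice the vertex sum at a pendant vertex over the centre of the star. -/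
theorem two_mul_pendant_centre (i : Fin m) :
    2 * ((∑ j, label b σ (1, i, j) : ℕ) : ℤ) =
      ((2 * b + 1) * n - 1) * (m * n) + 2 * n * (i + 1) := by
  have h := two_mul_sum_row (n := n) (b * (m * n) + 1) i
  have e : ((∑ j, label b σ (1, i, j) : ℕ) : ℤ) =
      ∑ j : Fin n, (b * (m * n) + 1 + position i j : ℤ) := by
    push_cast
    refine sum_congr rfl fun j _ => ?_
    change ((b * (m * n) + position i j + 1 : ℕ) : ℤ) = _
    push_cast
    ring
  rw [e, h]
  ring

/-- Twice the vertex sum at a rim vertex over the centre of the star. -/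
theorem two_mul_rim_centre (hb : b = 1 ∨ b = 2 ∨ b = 3) (i : Fin m) :
    2 * ((∑ j, label b σ (0, i, j) + ∑ j, label b σ (2, i, j) + ∑ j, label b σ (3, i, j) +
        ∑ j, label b σ (5, i, j) : ℕ) : ℤ) =
      (2 * (13 - b) * n - 2) * (m * n) + n * (4 * i + 6) := by
  have h0 := two_mul_sum_row (n := n) 1 i
  have h2 := two_mul_sum_row (n := n) (block b 2 * (m * n) + 1) i
  have h3 := two_mul_sum_row (n := n) (block b 3 * (m * n) + 1) i.rev
  have h5 := two_mul_sum_row (n := n) (5 * (m * n) + 1) i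
  have hrev : ((i.rev : ℕ) : ℤ) = m - 1 - i := by
    rw [Fin.val_rev]; push_cast [Nat.succ_le_of_lt i.2]; ring
  have hblock : (block b 2 + block b 3 + b : ℤ) = 6 := mod_cast block_two_add_block_three hb
  have e0 : ∑ j, (label b σ (0, i, j) : ℤ) = ∑ j : Fin n, (1 + position i j : ℤ) := by
    refine sum_congr rfl fun j _ => ?_
    simp [label, offset, block, add_comm]
  have e2 : ∑ j, (label b σ (2, i, j) : ℤ) =
      ∑ j : Fin n, (block b 2 * (m * n) + 1 + position i j : ℤ) := by
    refine sum_congr rfl fun j _ => ?_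
    simp only [label, offset]
    push_cast
    ring
  have e3 : ∑ j, (label b σ (3, i, j) : ℤ) =
      ∑ j : Fin n, (block b 3 * (m * n) + 1 + position i.rev j : ℤ) := by
    refine sum_congr rfl fun j _ => ?_
    simp only [label, offset]
    push_cast
    ring
  have e5 : ∑ j, (label b σ (5, i, j) : ℤ) =
      ∑ j : Fin n, (5 * (m * n) + 1 + position i j : ℤ) := by
    have hlabel : ∀ j : Fin n, (label b σ (5, i, j) : ℤ) = 5 * (m * n) + 1 +
        position i (if (i : ℕ) < (m - 1) / 2 then j.rev else j) := by
      intro j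
      change ((5 * (m * n) +
        position i (if (i : ℕ) < (m - 1) / 2 then j.rev else j) + 1 : ℕ) : ℤ) = _
      push_cast
      ring
    simp only [hlabel]
    split_ifs
    · exact Equiv.sum_comp Fin.revPerm fun j => (5 * (m * n) + 1 + position i j : ℤ)
    · rfl
  push_cast
  rw [e0, e2, e3, e5]
  rw [hrev] at h3
  linear_combination h0 + h2 + h3 + h5 + 2 * n * (m * n) * hblock

/-- Twice the vertex sum at the hub over a leaf of the star. The coefficient
`m - 2 * ((m - 1) / 2)` is `1` for odd `m` and `2` for even `m`; in particular the sum is strictly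
increasing in `j`. -/
theorem two_mul_hub_leaf (j : Fin n) :
    2 * ((∑ i, label b σ (5, i, j) : ℕ) : ℤ) =
      (11 * m - (m - 2 * ((m - 1) / 2) : ℕ)) * (m * n) + m +
        (m - 2 * ((m - 1) / 2) : ℕ) * m * (2 * j + 1) := by
  have hr : (m - 1) / 2 ≤ m := by omega
  have h := two_mul_sum_column hr (5 * (m * n) + 1) j
  have e : ((∑ i, label b σ (5, i, j) : ℕ) : ℤ) = ∑ i : Fin m, (5 * (m * n) + 1 +
      position i (if (i : ℕ) < (m - 1) / 2 then j.rev else j) : ℤ) := by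
    push_cast
    refine sum_congr rfl fun i _ => ?_
    change ((5 * (m * n) +
      position i (if (i : ℕ) < (m - 1) / 2 then j.rev else j) + 1 : ℕ) : ℤ) = _
    push_cast
    ring
  rw [e, h, Nat.cast_sub (by omega)]
  push_cast
  ring

/-- Twice the vertex sum at the hub over the centre, which is the sum of all labels of class `4`,
whatever their order. -/
theorem two_mul_hub_centre (hσ : Function.Injective σ) (hlt : ∀ x, σ x < m * n) :
    2 * ((∑ i, ∑ j, label b σ (4, i, j) : ℕ) : ℤ) = (9 * m * n + 1) * (m * n) := by
  have h := two_mul_sum_of_injective hσ (by simpa using hlt)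
  have e : ((∑ i, ∑ j, label b σ (4, i, j) : ℕ) : ℤ) =
      ∑ x : Fin m × Fin n, (4 * (m * n) + 1 + σ x : ℤ) := by
    rw [Fintype.sum_prod_type]
    push_cast
    refine sum_congr rfl fun i _ => sum_congr rfl fun j _ => ?_
    change ((4 * (m * n) + σ (i, j) + 1 : ℕ) : ℤ) = _
    push_cast
    ring
  rw [e, sum_add_distrib, mul_add, h]
  simp
  ring

end LabelSums

/-! ### Distinctness of the vertex sums -/

/-- The vertices form six classes: pendant, rim and hub vertices over the leaves (`A`, `B`, `C`),
pendant and rim vertices over the centre (`D`, `E`), and the hub over the centre (`F`). A function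
is injective if it is so on each class and takes no common value on two classes. -/
theorem injective_of_injective_on_classes {α β : Type*}
    {φ : (Option α ⊕ α) × (Fin 1 ⊕ β) → ℕ}
    (hA : ∀ i j i' j', φ (.inr i, .inr j) = φ (.inr i', .inr j') → i = i' ∧ j = j')
    (hB : ∀ i j i' j', φ (.inl (some i), .inr j) = φ (.inl (some i'), .inr j') → i = i' ∧ j = j')
    (hC : ∀ j j', φ (.inl none, .inr j) = φ (.inl none, .inr j') → j = j')
    (hD : ∀ i i', φ (.inr i, .inl 0) = φ (.inr i', .inl 0) → i = i')
    (hE : ∀ i i', φ (.inl (some i), .inl 0) = φ (.inl (some i'), .inl 0) → i = i')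
    (hAB : ∀ i j i' j', φ (.inr i, .inr j) ≠ φ (.inl (some i'), .inr j'))
    (hAC : ∀ i j j', φ (.inr i, .inr j) ≠ φ (.inl none, .inr j'))
    (hAD : ∀ i j i', φ (.inr i, .inr j) ≠ φ (.inr i', .inl 0))
    (hAE : ∀ i j i', φ (.inr i, .inr j) ≠ φ (.inl (some i'), .inl 0))
    (hAF : ∀ i j, φ (.inr i, .inr j) ≠ φ (.inl none, .inl 0))
    (hBC : ∀ i j j', φ (.inl (some i), .inr j) ≠ φ (.inl none, .inr j'))
    (hBD : ∀ i j i', φ (.inl (some i), .inr j) ≠ φ (.inr i', .inl 0))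
    (hBE : ∀ i j i', φ (.inl (some i), .inr j) ≠ φ (.inl (some i'), .inl 0))
    (hBF : ∀ i j, φ (.inl (some i), .inr j) ≠ φ (.inl none, .inl 0))
    (hCD : ∀ j i', φ (.inl none, .inr j) ≠ φ (.inr i', .inl 0))
    (hCE : ∀ j i', φ (.inl none, .inr j) ≠ φ (.inl (some i'), .inl 0))
    (hCF : ∀ j, φ (.inl none, .inr j) ≠ φ (.inl none, .inl 0))
    (hDE : ∀ i i', φ (.inr i, .inl 0) ≠ φ (.inl (some i'), .inl 0))
    (hDF : ∀ i, φ (.inr i, .inl 0) ≠ φ (.inl none, .inl 0))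
    (hEF : ∀ i, φ (.inl (some i), .inl 0) ≠ φ (.inl none, .inl 0)) :
    Function.Injective φ := by
  rintro ⟨(_ | i) | i, a | j⟩ ⟨(_ | i') | i', a' | j'⟩ h
  all_goals
    first
    | obtain rfl := Subsingleton.elim 0 a
    | skip
  all_goals
    first
    | obtain rfl := Subsingleton.elim 0 a'
    | skip
  all_goals grind

section Bounds

variable {m n b : ℕ} (σ : Fin m × Fin n → ℕ)

theorem pendant_leaf_le (i : Fin m) (j : Fin n) : (label b σ (0, i, j) : ℤ) ≤ m * n := by
  have h : label b σ (0, i, j) = position i j + 1 := by simp [label, offset, block]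
  have := position_lt i j
  rw [h]
  exact_mod_cast this

/-- The four classes of edges at a rim vertex over a leaf use the blocks `1`, `2`, `3` and `4`,
whose positions add up to `10`. -/
theorem rim_leaf_bounds (hb : b = 1 ∨ b = 2 ∨ b = 3) (hlt : ∀ x, σ x < m * n)
    (i i' i'' : Fin m) (j : Fin n) :
    10 * ((m : ℤ) * n) < (label b σ (1, i, j) + label b σ (2, i', j) + label b σ (3, i'', j) +
        label b σ (4, i, j) : ℕ) ∧
      ((label b σ (1, i, j) + label b σ (2, i', j) + label b σ (3, i'', j) +
        label b σ (4, i, j) : ℕ) : ℤ) ≤ 14 * ((m : ℤ) * n) := by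
  have h1 := offset_lt hlt 1 i j
  have h2 := offset_lt hlt 2 i' j
  have h3 := offset_lt hlt 3 i'' j
  have h4 := offset_lt hlt 4 i j
  have hblock : (b + block b 2 + block b 3 + 4) * (m * n) = 10 * (m * n) := by
    congr 1
    have := block_two_add_block_three hb
    omega
  have e : label b σ (1, i, j) + label b σ (2, i', j) + label b σ (3, i'', j) +
      label b σ (4, i, j) = 10 * (m * n) + (offset σ 1 i j + offset σ 2 i' j +
        offset σ 3 i'' j + offset σ 4 i j + 4) := by
    rw [← hblock]
    change (b * (m * n) + offset σ 1 i j + 1) + (block b 2 * (m * n) + offset σ 2 i' j + 1) +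
      (block b 3 * (m * n) + offset σ 3 i'' j + 1) + (4 * (m * n) + offset σ 4 i j + 1) = _
    ring
  rw [e]
  constructor
  · exact_mod_cast (by omega : 10 * (m * n) < _)
  · exact_mod_cast (by omega : _ ≤ 14 * (m * n))

theorem pendant_centre_bounds (i : Fin m) (hn : 0 < n) :
    ((2 * b + 1) * n - 1) * ((m : ℤ) * n) < 2 * (∑ j, label b σ (1, i, j) : ℕ) ∧
      2 * ((∑ j, label b σ (1, i, j) : ℕ) : ℤ) ≤ ((2 * b + 1) * n + 1) * ((m : ℤ) * n) := by
  rw [two_mul_pendant_centre]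
  have hi : (i : ℤ) + 1 ≤ m := mod_cast i.2
  have hn' : (0 : ℤ) < n := mod_cast hn
  have h1 : (0 : ℤ) < n * (i + 1) := by positivity
  have h2 : (n : ℤ) * (i + 1) ≤ n * m := mul_le_mul_of_nonneg_left hi hn'.le
  constructor <;> linarith

theorem rim_centre_bounds (hb : b = 1 ∨ b = 2 ∨ b = 3) (i : Fin m) (hn : 0 < n) :
    (2 * (13 - b) * n - 2) * ((m : ℤ) * n) <
        2 * (∑ j, label b σ (0, i, j) + ∑ j, label b σ (2, i, j) + ∑ j, label b σ (3, i, j) +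
          ∑ j, label b σ (5, i, j) : ℕ) ∧
      2 * ((∑ j, label b σ (0, i, j) + ∑ j, label b σ (2, i, j) + ∑ j, label b σ (3, i, j) +
          ∑ j, label b σ (5, i, j) : ℕ) : ℤ) ≤
        (2 * (13 - b) * n + 2) * ((m : ℤ) * n) + 2 * n := by
  rw [two_mul_rim_centre σ hb]
  have hi : (i : ℤ) + 1 ≤ m := mod_cast i.2
  have hn' : (0 : ℤ) < n := mod_cast hn
  have h1 : (0 : ℤ) < n * (4 * i + 6) := by positivity
  have h2 : (n : ℤ) * (i + 1) ≤ n * m := mul_le_mul_of_nonneg_left hi hn'.le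
  constructor <;> linarith

theorem hub_leaf_bounds {s : ℕ} (hs : s = m - 2 * ((m - 1) / 2)) (hm : 0 < m) (j : Fin n) :
    (11 * m - s) * ((m : ℤ) * n) + 2 * m ≤ 2 * (∑ i, label b σ (5, i, j) : ℕ) ∧
      2 * ((∑ i, label b σ (5, i, j) : ℕ) : ℤ) ≤ (11 * m + s) * ((m : ℤ) * n) := by
  rw [two_mul_hub_leaf, ← hs]
  have hj : (j : ℤ) + 1 ≤ n := mod_cast j.2
  have hs1 : (1 : ℤ) ≤ s := by omega
  have hm' : (0 : ℤ) ≤ m := by positivity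
  have h1 : (1 : ℤ) * m ≤ s * m := mul_le_mul_of_nonneg_right hs1 hm'
  have h2 : (s * m : ℤ) * (j + 1) ≤ s * m * n := mul_le_mul_of_nonneg_left hj (by positivity)
  have h3 : (0 : ℤ) ≤ s * m * j := by positivity
  constructor <;> linarith

end Bounds

/-- For a block choice `b` as in `exists_block_choice` and a `σ` that separates the rim vertices
over the leaves, all vertex sums are distinct. The local names `A`, …, `F` are those of
`injective_of_injective_on_classes`. -/
theorem vertexSum_injective {m n b : ℕ} [NeZero m] (hm : 3 ≤ m) (hn : 2 ≤ n)
    (hb : b = 1 ∨ b = 2 ∨ b = 3)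
    (hBD' : (2 * b + 1) * n + 1 ≤ 20 ∨ 29 ≤ (2 * b + 1) * n)
    (hCD' : (2 * b + 1) * n + 1 + (m - 2 * ((m - 1) / 2)) ≤ 11 * m ∨
        11 * m + (m - 2 * ((m - 1) / 2)) + 1 ≤ (2 * b + 1) * n)
    (hCE' : 11 * m + (m - 2 * ((m - 1) / 2)) + 2 ≤ 2 * (13 - b) * n ∨
        2 * (13 - b) * n + 2 + (m - 2 * ((m - 1) / 2)) ≤ 11 * m)
    {σ : Fin m × Fin n → ℕ} (hσ : Function.Injective σ) (hlt : ∀ x, σ x < m * n)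
    (hsort : Function.Injective fun x : Fin m × Fin n =>
      label b σ (1, x.1, x.2) + label b σ (2, x.1 - 1, x.2) + label b σ (3, x.1 + 1, x.2) +
        label b σ (4, x.1, x.2))
    {f : Sym2 ((Option (Fin m) ⊕ Fin m) × (Fin 1 ⊕ Fin n)) → ℕ}
    (hf : ∀ k, f (edge m n k) = label b σ k) :
    Function.Injective (vertexSum (tensorProduct (helm m) (star n)) f) := by
  obtain ⟨s, hs⟩ : ∃ s, s = m - 2 * ((m - 1) / 2) := ⟨_, rfl⟩
  rw [← hs] at hCD' hCE'
  have hs1 : 1 ≤ s := by omega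
  have hs2 : s ≤ 2 := by omega
  have hb13 : ((13 - b : ℕ) : ℤ) = 13 - b := by omega
  have hN : (0 : ℤ) < m * n := by positivity
  have hmn3 : 3 * (n : ℤ) ≤ m * n := by gcongr; exact_mod_cast hm
  have hmn2 : (m : ℤ) * 2 ≤ m * n := by gcongr; exact_mod_cast hn
  -- comparisons of multiples of `m * n` reduce to comparisons of the coefficients
  have mul : ∀ {x y : ℤ}, x ≤ y → x * (m * n) ≤ y * (m * n) := fun h =>
    mul_le_mul_of_nonneg_right h hN.le
  have hA := fun i j => pendant_leaf_le (b := b) σ i j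
  have hB := fun i j => rim_leaf_bounds σ hb hlt i (i - 1) (i + 1) j
  have hC := fun j => hub_leaf_bounds (b := b) σ hs (by omega) j
  have hD := fun i => pendant_centre_bounds (b := b) σ i (by omega)
  have hE := fun i => rim_centre_bounds σ hb i (by omega)
  have hF := two_mul_hub_centre (b := b) σ hσ hlt
  have vF := vertexSum_hub_centre hm _ f hf
  have vE := vertexSum_rim_centre hm _ f hf
  have vD := vertexSum_pendant_centre hm _ f hf
  have vC := vertexSum_hub_leaf hm _ f hf
  have vB := vertexSum_rim_leaf hm _ f hf
  have vA := vertexSum_pendant_leaf hm _ f hf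
  simp only [← vA] at hA
  simp only [← vB] at hB
  simp only [← vC] at hC
  simp only [← vD] at hD
  simp only [← vE] at hE
  rw [← vF] at hF
  have hbn : (n : ℤ) ≤ b * n ∧ (b : ℤ) * n ≤ 3 * n := by
    constructor <;> nlinarith [show (1 : ℤ) ≤ b ∧ (b : ℤ) ≤ 3 by omega]
  have hm3 : (3 : ℤ) ≤ m := mod_cast hm
  have hn2 : (2 : ℤ) ≤ n := mod_cast hn
  have hs1' : (1 : ℤ) ≤ s := mod_cast hs1
  have hs2' : (s : ℤ) ≤ 2 := mod_cast hs2
  have hms : (32 : ℤ) ≤ 11 * m - s := by omega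
  refine injective_of_injective_on_classes ?_ ?_ ?_ ?_ ?_ ?_ ?_ ?_ ?_ ?_ ?_ ?_ ?_ ?_ ?_ ?_ ?_ ?_
    ?_ ?_
  · intro i j i' j' h
    rw [vA, vA] at h
    simpa using label_injective hb hσ hlt h
  · intro i j i' j' h
    rw [vB, vB] at h
    simpa using @hsort (i, j) (i', j') h
  · intro j j' h
    have h1 := two_mul_hub_leaf (b := b) σ j
    have h2 := two_mul_hub_leaf (b := b) σ j'
    rw [← vC, ← hs] at h1 h2
    rw [h, h2] at h1
    have h3 : (s * m : ℤ) ≠ 0 := by positivity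
    have h4 : (s * m : ℤ) * j = s * m * j' := by linarith
    exact Fin.ext (Int.natCast_inj.1 (mul_left_cancel₀ h3 h4))
  · intro i i' h
    have h1 := two_mul_pendant_centre (b := b) σ i
    have h2 := two_mul_pendant_centre (b := b) σ i'
    rw [← vD] at h1 h2
    rw [h, h2] at h1
    have h3 : (n : ℤ) ≠ 0 := by positivity
    have h4 : (n : ℤ) * i = n * i' := by linarith
    exact Fin.ext (Int.natCast_inj.1 (mul_left_cancel₀ h3 h4))
  · intro i i' h
    have h1 := two_mul_rim_centre σ hb i
    have h2 := two_mul_rim_centre σ hb i'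
    rw [← vE] at h1 h2
    rw [h, h2] at h1
    have h3 : (n : ℤ) ≠ 0 := by positivity
    have h4 : (n : ℤ) * i = n * i' := by linarith
    exact Fin.ext (Int.natCast_inj.1 (mul_left_cancel₀ h3 h4))
  · intro i j i' j' h
    have := hA i j
    have := hB i' j'
    omega
  · intro i j j' h
    have := hA i j
    have := hC j'
    have := mul hms
    omega
  · intro i j i' h
    have := hA i j
    have := hD i'
    have := mul (show 2 ≤ (2 * (b : ℤ) + 1) * n - 1 by linarith)
    omega
  · intro i j i' h
    have := hA i j
    have := hE i'
    have := mul (show 2 ≤ 2 * (13 - (b : ℤ)) * n - 2 by linarith)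
    omega
  · intro i j h
    have := hA i j
    have := mul (show 3 ≤ 9 * (m : ℤ) * n + 1 by linarith)
    rw [← h] at hF
    linarith
  · intro i j j' h
    have := hB i j
    have := hC j'
    have := mul hms
    omega
  · intro i j i' h
    have := hB i j
    have := hD i'
    rcases hBD' with hk | hk
    · have := mul (show (2 * (b : ℤ) + 1) * n + 1 ≤ 20 by exact_mod_cast hk)
      omega
    · have := mul (show 28 ≤ (2 * (b : ℤ) + 1) * n - 1 by
        have : (29 : ℤ) ≤ (2 * b + 1) * n := by exact_mod_cast hk
        linarith)
      omega
  · intro i j i' h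
    have := hB i j
    have := hE i'
    have := mul (show 28 ≤ 2 * (13 - (b : ℤ)) * n - 2 by linarith)
    omega
  · intro i j h
    have := hB i j
    have := mul (show 29 ≤ 9 * (m : ℤ) * n + 1 by linarith)
    rw [← h] at hF
    linarith
  · intro j i' h
    have := hC j
    have := hD i'
    rcases hCD' with hk | hk
    · have := mul (show (2 * (b : ℤ) + 1) * n + 1 ≤ 11 * m - s by
        have : (2 * (b : ℤ) + 1) * n + 1 + s ≤ 11 * m := by exact_mod_cast hk
        linarith)
      omega
    · have := mul (show 11 * (m : ℤ) + s ≤ (2 * (b : ℤ) + 1) * n - 1 by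
        have : 11 * (m : ℤ) + s + 1 ≤ (2 * b + 1) * n := by exact_mod_cast hk
        linarith)
      omega
  · intro j i' h
    have := hC j
    have := hE i'
    rcases hCE' with hk | hk
    · have := mul (show 11 * (m : ℤ) + s ≤ 2 * (13 - (b : ℤ)) * n - 2 by
        rw [← hb13]
        have : 11 * (m : ℤ) + s + 2 ≤ 2 * (13 - b : ℕ) * n := by exact_mod_cast hk
        linarith)
      omega
    · have hk' : 2 * (13 - (b : ℤ)) * n + 2 + s ≤ 11 * m := by
        rw [← hb13]
        exact_mod_cast hk
      have := mul (show 2 * (13 - (b : ℤ)) * n + 2 ≤ 11 * m - s by linarith)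
      -- the upper bound at the rim carries an extra `2 * n`, the lower bound at the hub `2 * m`
      have : (n : ℤ) < m := by linarith
      omega
  · intro j h
    have := hC j
    have := mul (show 11 * (m : ℤ) + s + 1 ≤ 9 * (m : ℤ) * n + 1 by linarith)
    rw [← h] at hF
    linarith
  · intro i i' h
    have := hD i
    have := hE i'
    have := mul (show (2 * (b : ℤ) + 1) * n + 1 ≤ 2 * (13 - (b : ℤ)) * n - 2 by linarith)
    omega
  · intro i h
    have := hD i
    have := mul (show (2 * (b : ℤ) + 1) * n + 2 ≤ 9 * (m : ℤ) * n + 1 by linarith)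
    rw [← h] at hF
    linarith
  · intro i h
    have := hE i
    have := mul (show 2 * (13 - (b : ℤ)) * n + 4 ≤ 9 * (m : ℤ) * n + 1 by linarith)
    rw [← h] at hF
    linarith

end AntimagicLabeling

theorem mainTheorem2 (m n : ℕ) (hm : 3 ≤ m) (hn : 2 ≤ n) :
    (AntimagicLabeling.tensorProduct (AntimagicLabeling.helm m)
        (AntimagicLabeling.star n)).edgeSet.ncard = 6 * m * n ∧
      AntimagicLabeling.IsAntimagic
        (AntimagicLabeling.tensorProduct (AntimagicLabeling.helm m)
          (AntimagicLabeling.star n)) := by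
  have : NeZero m := ⟨by omega⟩
  have hcard : Fintype.card (Fin 6 × Fin m × Fin n) = 6 * (m * n) := by simp
  open AntimagicLabeling in
  constructor
  · rw [← range_edge n hm, ← Set.image_univ,
      Set.ncard_image_of_injective _ (edge_injective n hm), Set.ncard_univ,
      Nat.card_eq_fintype_card, hcard, mul_assoc]
  · obtain ⟨b, hb, h1, h2, h3⟩ := exists_block_choice hm hn
    -- the classes 1, 2 and 3 do not involve `σ`, so that `σ` may be chosen after their labels
    obtain ⟨σ, hσ, hlt, hsort⟩ := exists_rank_add_injective fun x : Fin m × Fin n =>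
      label b 0 (1, x.1, x.2) + label b 0 (2, x.1 - 1, x.2) + label b 0 (3, x.1 + 1, x.2)
    have hlt' : ∀ x, σ x < m * n := by simpa using hlt
    refine isAntimagic_of_enumeration _ (edge m n) (edge_injective n hm) (range_edge n hm)
      (label b σ) (label_injective hb hσ hlt') (fun k => Nat.succ_pos _)
      (fun k => hcard ▸ label_le hb hlt' k) fun f hf =>
        vertexSum_injective hm hn hb h1 h2 h3 hσ hlt' (fun x y h => hsort ?_) hf
    have key : ∀ x : Fin m × Fin n, label b σ (4, x.1, x.2) = σ x + (4 * (m * n) + 1) :=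
      fun x => by
        change 4 * (m * n) + σ x + 1 = _
        ring
    simp only [key, ← add_assoc, Nat.add_right_cancel_iff] at h
    exact h
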